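/- Let $n\ge 2$ and let $K\subset\mathbb R^n$ be a symmetric convex body (compact, convex, with non-empty interior, $K=-K$), with support function $h_K(u)=\sup_{y\in K}\langle u,y\rangle$ and surface area measure $S_K$ (the push-forward of the $(n-1)$-dimensional Hausdorff measure on $\partial K$ under the Gauss map $x\mapsto n_x$). Write $|\cdot|_k$ for $k$-dimensional volume, $|\cdot|=|\cdot|_n$, and $K|H$ for the orthogonal projection of $K$ onto a linear subspace $H$. For $k=1,2$ and a compact convex set $M$ put $V_k(K,M)=\frac{(n-k)!}{n!}\frac{d^k}{dt^k}|K+tM|\big|_{t=0^+}$. A zonoid is a non-empty compact set that is a limit, in the Hausdorff metric, of zonotopes, i.e. of finite Minkowski sums of segments $[-v_i,v_i]$. Suppose that for every pair of linearly independent unit vectors $v,w\in\mathbb R^n$, $$4\sqrt{1-\langle v,w\rangle^2}\;\big|K|\mathrm{span}(v,w)^{\perp}\big|_{n-2}+\int_{\mathbb S^{n-1}}\frac{|\langle u,v\rangle|\,|\langle u,w\rangle|}{h_K(u)}\,dS_K(u)\;\le\;\frac{4\,\big|K|v^{\perp}\big|_{n-1}\,\big|K|w^{\perp}\big|_{n-1}}{|K|}.$$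 Then for every zonoid $M$, $$n(n-1)V_2(K,M)+\int_{\mathbb S^{n-1}}\frac{h_M(u)^2}{h_K(u)}\,dS_K(u)\;\le\;\frac{n^2\,V_1(K,M)^2}{|K|}.$$ -/

import Mathlib

open Set Filter Topology MeasureTheory
open scoped Pointwise InnerProductSpace

noncomputable section

namespace LocalLogBM

/-- Euclidean space `ℝⁿ`. -/
abbrev Rn (n : ℕ) : Type := EuclideanSpace ℝ (Fin n)

/-- A symmetric convex body: a compact convex set with non-empty interior and `K = -K`. -/
structure IsSymmConvexBody {n : ℕ} (K : Set (Rn n)) : Prop where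
  convex : Convex ℝ K
  isCompact : IsCompact K
  interior_nonempty : (interior K).Nonempty
  symm : ∀ x ∈ K, -x ∈ K

/-- The support function `h_K(u) = sup_{y ∈ K} ⟨u, y⟩`. -/
def supportFn {n : ℕ} (K : Set (Rn n)) (u : Rn n) : ℝ :=
  sSup ((fun y => ⟪u, y⟫_ℝ) '' K)

/-- `u` is an outer unit normal vector of `K` at the point `x`. -/
def IsOuterUnitNormal {n : ℕ} (K : Set (Rn n)) (x u : Rn n) : Prop :=
  ‖u‖ = 1 ∧ ∀ y ∈ K, ⟪u, y⟫_ℝ ≤ ⟪u, x⟫_ℝ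

/-- The regular boundary points of `K`: those with exactly one outer unit normal.
For a convex body they make up `(n-1)`-almost all of the boundary. -/
def regularBoundary {n : ℕ} (K : Set (Rn n)) : Set (Rn n) :=
  {x | x ∈ frontier K ∧ ∃! u, IsOuterUnitNormal K x u}

open Classical in
/-- The Gauss map `x ↦ n_x`, which sends a regular boundary point to its outer unit normal
(and takes the irrelevant value `0` elsewhere). -/
def gaussMap {n : ℕ} (K : Set (Rn n)) (x : Rn n) : Rn n :=
  if h : x ∈ regularBoundary K then h.2.choose else 0

/-- The surface area measure `S_K`: the push-forward, under the Gauss map, of the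
`(n-1)`-dimensional Hausdorff measure (normalised to agree with Lebesgue measure) on the regular
part of the boundary of `K`. It is a measure on `ℝⁿ` concentrated on the unit sphere. -/
def surfaceAreaMeasure {n : ℕ} (K : Set (Rn n)) : Measure (Rn n) :=
  Measure.map (gaussMap K) ((μHE[n - 1] : Measure (Rn n)).restrict (regularBoundary K))

/-- The orthogonal projection `K|H = {x ∈ H : ∃ y ∈ H^⊥, x + y ∈ K}`. -/
def projSet {n : ℕ} (K : Set (Rn n)) (H : Submodule ℝ (Rn n)) : Set (Rn n) :=
  {x | x ∈ H ∧ ∃ y ∈ Hᗮ, x + y ∈ K}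

/-- The `k`-dimensional volume of the orthogonal projection `K|H`. -/
def projVol {n : ℕ} (k : ℕ) (K : Set (Rn n)) (H : Submodule ℝ (Rn n)) : ℝ :=
  (μHE[k] : Measure (Rn n)).real (projSet K H)

/-- The mixed volume `V_k(K, M) = ((n-k)!/n!) · (d/dt)^k |K + tM|` at `t = 0`, where the
derivative is one-sided (`t ≥ 0`). -/
def mixedVol {n : ℕ} (k : ℕ) (K M : Set (Rn n)) : ℝ :=
  ((n - k).factorial : ℝ) / (n.factorial : ℝ) *
    iteratedDerivWithin k (fun t : ℝ => volume.real (K + t • M)) (Ici 0) 0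

/-- A zonotope: a finite Minkowski sum of segments `[-v_i, v_i]`. -/
def IsZonotope {n : ℕ} (Z : Set (Rn n)) : Prop :=
  ∃ (N : ℕ) (v : Fin N → Rn n), Z = ∑ i, segment ℝ (-(v i)) (v i)

/-- A zonoid: a non-empty compact set that is a limit of zonotopes in the Hausdorff metric
(such a set is automatically convex and symmetric). -/
def IsZonoid {n : ℕ} (M : Set (Rn n)) : Prop :=
  IsCompact M ∧ M.Nonempty ∧
    ∃ Z : ℕ → Set (Rn n), (∀ k, IsZonotope (Z k)) ∧
      Tendsto (fun k => Metric.hausdorffDist (Z k) M) atTop (𝓝 0)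

theorem isCompact_normalPairs {n : ℕ} {K : Set (Rn n)} (hK : IsCompact K) :
    IsCompact {p : Rn n × Rn n | p.1 ∈ frontier K ∧ IsOuterUnitNormal K p.1 p.2} := by
  have h1 : IsCompact (frontier K) :=
    hK.of_isClosed_subset isClosed_frontier hK.isClosed.frontier_subset
  refine (h1.prod (isCompact_sphere (0 : Rn n) 1)).of_isClosed_subset ?_ ?_
  · have : {p : Rn n × Rn n | p.1 ∈ frontier K ∧ IsOuterUnitNormal K p.1 p.2} =
        {p | p.1 ∈ frontier K} ∩ ({p | ‖p.2‖ = 1} ∩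
          ⋂ y ∈ K, {p : Rn n × Rn n | ⟪p.2, y⟫_ℝ ≤ ⟪p.2, p.1⟫_ℝ}) := by
      ext p; simp [IsOuterUnitNormal]
    rw [this]
    refine (isClosed_frontier.preimage continuous_fst).inter
      ((isClosed_eq (by fun_prop) (by fun_prop)).inter ?_)
    exact isClosed_biInter fun y _ => isClosed_le (by fun_prop) (by fun_prop)
  · rintro p ⟨hp, hu, -⟩
    exact ⟨hp, by simpa using hu⟩

theorem measurableSet_regularBoundary {n : ℕ} {K : Set (Rn n)} (hK : IsCompact K) :
    MeasurableSet (regularBoundary K) := by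
  have hN := isCompact_normalPairs hK
  set N := {p : Rn n × Rn n | p.1 ∈ frontier K ∧ IsOuterUnitNormal K p.1 p.2} with hNdef
  let T : ℕ → Set ((Rn n × Rn n) × (Rn n × Rn n)) := fun k =>
    (N ×ˢ N) ∩ {q | q.1.1 = q.2.1 ∧ 1 / ((k : ℝ) + 1) ≤ dist q.1.2 q.2.2}
  have hT : ∀ k, IsCompact (T k) := fun k => (hN.prod hN).inter_right
    ((isClosed_eq (continuous_fst.comp continuous_fst) (continuous_fst.comp continuous_snd)).inter
      (isClosed_le continuous_const
        ((continuous_snd.comp continuous_fst).dist (continuous_snd.comp continuous_snd))))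
  have : regularBoundary K =
      (Prod.fst '' N) \ ⋃ k, (fun q : (Rn n × Rn n) × (Rn n × Rn n) => q.1.1) '' (T k) := by
    ext x
    constructor
    · rintro ⟨hx, u, hu, huu⟩
      refine ⟨⟨(x, u), ⟨hx, hu⟩, rfl⟩, ?_⟩
      simp only [mem_iUnion, not_exists]
      rintro k ⟨⟨⟨a, b⟩, ⟨c, d⟩⟩, ⟨⟨h1, h2⟩, h3, h4⟩, rfl⟩
      obtain rfl : a = c := h3
      have hb : b = u := huu _ h1.2
      have hd : d = u := huu _ h2.2
      subst hb; subst hd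
      simp only [dist_self] at h4
      have : (0 : ℝ) < 1 / ((k : ℝ) + 1) := by positivity
      linarith
    · rintro ⟨⟨⟨a, u⟩, ⟨ha, hu⟩, rfl⟩, hx⟩
      refine ⟨ha, u, hu, fun u' hu' => ?_⟩
      by_contra hne
      obtain ⟨k, hk⟩ := exists_nat_one_div_lt (dist_pos.2 hne)
      exact hx (mem_iUnion.2 ⟨k, ((a, u'), (a, u)), ⟨⟨⟨ha, hu'⟩, ⟨ha, hu⟩⟩, rfl, hk.le⟩, rfl⟩)
  rw [this]
  refine (hN.image continuous_fst).measurableSet.diff (MeasurableSet.iUnion fun k => ?_)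
  exact ((hT k).image (by fun_prop)).measurableSet

/-- The Gauss map is measurable, so that the push-forward defining `S_K` is a genuine one. -/
theorem measurable_gaussMap {n : ℕ} {K : Set (Rn n)} (hK : IsCompact K) :
    Measurable (gaussMap K) := by
  have hR := measurableSet_regularBoundary hK
  have hN := isCompact_normalPairs hK
  refine measurable_of_isClosed fun C hC => ?_
  have key : gaussMap K ⁻¹' C =
      (regularBoundary K ∩ Prod.fst '' ({p : Rn n × Rn n | p.1 ∈ frontier K ∧
        IsOuterUnitNormal K p.1 p.2} ∩ Prod.snd ⁻¹' C)) ∪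
      ((regularBoundary K)ᶜ ∩ {_x | (0 : Rn n) ∈ C}) := by
    ext x
    by_cases hx : x ∈ regularBoundary K
    · have hs := hx.2.choose_spec
      simp only [mem_preimage, gaussMap, hx, dif_pos, mem_union, mem_inter_iff, true_and,
        mem_compl_iff, not_true_eq_false, false_and, or_false]
      constructor
      · intro h
        exact ⟨(x, hx.2.choose), ⟨⟨hx.1, hs.1⟩, h⟩, rfl⟩
      · rintro ⟨⟨a, u⟩, ⟨⟨_, hu⟩, huC⟩, rfl⟩
        rw [← hs.2 u hu]; exact huC
    · simp [gaussMap, hx]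
  rw [key]
  refine (hR.inter ?_).union (hR.compl.inter (MeasurableSet.const _))
  exact ((hN.inter_right (hC.preimage continuous_snd)).image continuous_fst).measurableSet

end LocalLogBM

end

namespace LocalLogBM

/-! The inequality is quadratic in `M`, and for zonotopes it is a sum of the hypothesis over pairs
of generating segments. Let `M = ∑ [-vᵢ, vᵢ]`. By Fubini, adding `t[-v, v]` to a convex body raises
its volume by `t` times `2‖v‖` times the volume of its projection along `v`. Iterating this, the
volume of `K + tM` is a polynomial in `t` whose linear coefficient is the sum of the rates
`segmentRate K vᵢ` and whose quadratic coefficient is the sum of `segmentRate₂ K vᵢ vⱼ` over `i < j`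
(`exists_polynomial_volume_add_zonotope`). Since also `h_M(u) = ∑ |⟪u, vᵢ⟫|`, expanding both squares
reduces the claim to one inequality for each ordered pair `(vᵢ, vⱼ)`.

For independent vectors this is the hypothesis, rescaled. For parallel vectors, diagonal pairs
included, the mixed rate vanishes, and the remaining bound on the integral is a limit of the
independent case after dropping its nonnegative mixed rate (`UnitPairInequality.pair_le`). Summation
gives `UnitPairInequality.zonotope_le`.

Zonoids follow by approximation. The volume polynomials have bounded degree and converge pointwise
on `t ≥ 0`, so their coefficients converge (`exists_polynomial_limit`). The integrals converge by
dominated convergence (`tendsto_integral_supportFn_mul`), because `S_K` is finite and `h_K` is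
bounded below by a positive constant on the sphere. -/

theorem volume_add_Icc {I : Set ℝ} (hI : IsCompact I) (hc : Convex ℝ I) (hne : I.Nonempty)
    {t : ℝ} (ht : 0 ≤ t) :
    volume (I + Icc (-t) t) = volume I + ENNReal.ofReal (2 * t) := by
  have h := eq_Icc_of_connected_compact ⟨hne, hc.isPreconnected⟩ hI
  have hle : sInf I ≤ sSup I := csInf_le_csSup hne hI.bddBelow hI.bddAbove
  rw [h, Icc_add_Icc hle (by linarith), Real.volume_Icc, Real.volume_Icc,
    ← ENNReal.ofReal_add (by linarith) (by linarith)]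
  congr 1; ring

/-- The symmetric segment `[-v, v]`. -/
abbrev symmSegment {F : Type*} [AddCommGroup F] [Module ℝ F] (v : F) : Set F := segment ℝ (-v) v

/-! ### Segments and projections along a vector -/

section Projections

variable {E : Type*} [NormedAddCommGroup E] [InnerProductSpace ℝ E]

/-- Orthogonal projection onto the hyperplane orthogonal to `v`. -/
noncomputable abbrev hyperProj (v : E) : E →L[ℝ] (ℝ ∙ v)ᗮ := (ℝ ∙ v)ᗮ.orthogonalProjectionOnto

theorem symmSegment_eq_image (v : E) : symmSegment v = (fun s : ℝ => s • v) '' Icc (-1) 1 := by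
  rw [symmSegment, segment_eq_image_lineMap]
  ext x
  simp only [mem_image, AffineMap.lineMap_apply_module]
  constructor
  · rintro ⟨s, hs, rfl⟩
    exact ⟨2 * s - 1, ⟨by linarith [hs.1], by linarith [hs.2]⟩, by module⟩
  · rintro ⟨s, hs, rfl⟩
    exact ⟨(s + 1) / 2, ⟨by linarith [hs.1], by linarith [hs.2]⟩, by module⟩

theorem isCompact_symmSegment (v : E) : IsCompact (symmSegment v) := by
  rw [symmSegment_eq_image]
  exact isCompact_Icc.image (by fun_prop)

theorem smul_symmSegment (t : ℝ) (v : E) : t • symmSegment v = symmSegment (t • v) := by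
  rw [symmSegment_eq_image, symmSegment_eq_image, ← image_smul, image_image]
  refine image_congr fun s _ => ?_
  rw [smul_comm]

theorem hyperProj_smul_add {e : E} (s : ℝ) (y : (ℝ ∙ e)ᗮ) :
    hyperProj e (s • e + (y : E)) = y := by
  rw [map_add, map_smul, Submodule.orthogonalProjectionOnto_mem_subspace_eq_self]
  have : hyperProj e e = 0 := by
    rw [Submodule.orthogonalProjectionOnto_eq_zero_iff, Submodule.orthogonal_orthogonal]
    exact Submodule.mem_span_singleton_self e
  rw [this, smul_zero, zero_add]

theorem exists_smul_add_hyperProj (e x : E) : ∃ s : ℝ, x = s • e + (hyperProj e x : E) := by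
  have h := (ℝ ∙ e)ᗮ.sub_starProjection_mem_orthogonal x
  rw [Submodule.orthogonal_orthogonal, Submodule.mem_span_singleton] at h
  obtain ⟨s, hs⟩ := h
  refine ⟨s, ?_⟩
  rw [hs]; simp

end Projections

/-! ### Volume growth under addition of a segment -/

section SegmentVolume

variable {E : Type*} [NormedAddCommGroup E] [InnerProductSpace ℝ E] [FiniteDimensional ℝ E]
  [MeasurableSpace E] [BorelSpace E]

theorem measurePreserving_smul_add {e : E} (he : ‖e‖ = 1) :
    MeasurePreserving (fun p : ℝ × (ℝ ∙ e)ᗮ => p.1 • e + (p.2 : E)) := by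
  have h1 : MeasurePreserving (LinearIsometryEquiv.toSpanUnitSingleton (𝕜 := ℝ) e he) :=
    LinearIsometryEquiv.measurePreserving _
  have h2 : MeasurePreserving (Prod.map (LinearIsometryEquiv.toSpanUnitSingleton (𝕜 := ℝ) e he)
      (id : (ℝ ∙ e)ᗮ → (ℝ ∙ e)ᗮ)) :=
    h1.prod (MeasurePreserving.id (volume : Measure (ℝ ∙ e)ᗮ))
  have h3 := ((ℝ ∙ e).measurePreserving_measurableEquivProd (0 : E)).symm
  rw [InnerProductSpace.euclideanHausdorffMeasure_eq_volume] at h3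
  convert h3.comp h2 using 1
  ext p
  simp [Submodule.measurableEquivProd_symm_apply]

/-- Fubini along lines parallel to `e`: a line meets `L` in a compact interval, which grows by `2t`,
exactly when its base point lies in the projection of `L`; the other lines still miss the sum. -/
theorem volume_add_symmSegment_unit {e : E} (he : ‖e‖ = 1) {L : Set E} (hL : IsCompact L)
    (hc : Convex ℝ L) {t : ℝ} (ht : 0 ≤ t) :
    volume (L + symmSegment (t • e)) =
      volume L + ENNReal.ofReal (2 * t) * volume (hyperProj e '' L) := by
  have hmp := measurePreserving_smul_add he
  have hseg : symmSegment (t • e) = (fun s : ℝ => s • e) '' Icc (-t) t := by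
    rw [symmSegment_eq_image]
    ext x
    simp only [mem_image, smul_smul]
    constructor
    · rintro ⟨s, hs, rfl⟩
      exact ⟨s * t, ⟨by nlinarith [hs.1], by nlinarith [hs.2]⟩, rfl⟩
    · rintro ⟨s, hs, rfl⟩
      rcases ht.eq_or_lt with rfl | ht
      · exact ⟨0, by simp, by simp [show s = 0 by linarith [hs.1, hs.2]]⟩
      · refine ⟨s / t, ⟨?_, ?_⟩, by rw [div_mul_cancel₀ _ ht.ne']⟩
        · rw [le_div_iff₀ ht]; linarith [hs.1]
        · rw [div_le_iff₀ ht]; linarith [hs.2]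
  have hfib : ∀ S : Set E, IsCompact S → volume S =
      ∫⁻ y : (ℝ ∙ e)ᗮ, volume {s : ℝ | s • e + (y : E) ∈ S} := fun S hS => by
    rw [← hmp.measure_preimage hS.measurableSet.nullMeasurableSet]
    exact Measure.prod_apply_symm (hmp.measurable hS.measurableSet)
  have hS : IsCompact (symmSegment (t • e)) := isCompact_symmSegment _
  have himg : MeasurableSet (hyperProj e '' L) := (hL.image (hyperProj e).continuous).measurableSet
  rw [hfib _ (hL.add hS), hfib _ hL, ← lintegral_indicator_const himg, ← lintegral_add_right _
    (measurable_const.indicator himg)]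
  refine lintegral_congr fun y => ?_
  set I : Set ℝ := {s : ℝ | s • e + (y : E) ∈ L} with hI
  have hfibeq : {s : ℝ | s • e + (y : E) ∈ L + symmSegment (t • e)} = I + Icc (-t) t := by
    ext s
    rw [hseg]
    simp only [mem_ofPred_eq, Set.mem_add, hI]
    constructor
    · rintro ⟨l, hl, _, ⟨r, hr, rfl⟩, h⟩
      refine ⟨s - r, ?_, r, hr, by ring⟩
      convert hl using 1
      rw [sub_smul, sub_add_eq_add_sub, ← h]; simp
    · rintro ⟨a, ha, b, hb, rfl⟩
      exact ⟨_, ha, _, ⟨b, hb, rfl⟩, by module⟩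
  rw [hfibeq]
  by_cases hy : y ∈ hyperProj e '' L
  · rw [indicator_of_mem hy]
    have hanti : Topology.IsClosedEmbedding fun s : ℝ => s • e + (y : E) := by
      apply Isometry.isClosedEmbedding
      refine Isometry.of_dist_eq fun a b => ?_
      rw [dist_add_right, dist_eq_norm, ← sub_smul, norm_smul, he, mul_one, dist_eq_norm]
    refine volume_add_Icc (hanti.isCompact_preimage hL) ?_ ?_ ht
    · intro a ha b hb p q hp hq hpq
      have := hc ha hb hp hq hpq
      change (p • a + q • b) • e + (y : E) ∈ L
      convert this using 1
      have : (y : E) = (p + q) • (y : E) := by rw [hpq, one_smul]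
      nth_rewrite 1 [this]
      simp only [smul_eq_mul]
      module
    · obtain ⟨x, hx, rfl⟩ := hy
      obtain ⟨s, hs⟩ := exists_smul_add_hyperProj e x
      refine ⟨s, ?_⟩
      change s • e + (hyperProj e x : E) ∈ L
      rwa [← hs]
  · rw [indicator_of_notMem hy, add_zero]
    have : I = ∅ := by
      rw [eq_empty_iff_forall_notMem]
      intro s hs
      exact hy ⟨_, hs, hyperProj_smul_add s y⟩
    simp [this]

/-- Twice the volume of the projection of `L` along `v`, scaled by `‖v‖`: the growth rate of the
volume of `L + t[-v,v]`. -/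
noncomputable def segmentRate (L : Set E) (v : E) : ℝ :=
  2 * ‖v‖ * volume.real (hyperProj v '' L)

theorem segmentRate_nonneg (L : Set E) (v : E) : 0 ≤ segmentRate L v := by
  unfold segmentRate; positivity

theorem volume_add_smul_symmSegment {L : Set E} (hL : IsCompact L) (hc : Convex ℝ L) (v : E)
    {t : ℝ} (ht : 0 ≤ t) :
    volume.real (L + t • symmSegment v) = volume.real L + t * segmentRate L v := by
  rcases eq_or_ne v 0 with rfl | hv
  · rw [smul_symmSegment, smul_zero]
    simp [segmentRate, symmSegment]
  have hv' : 0 < ‖v‖ := norm_pos_iff.2 hv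
  set e : E := ‖v‖⁻¹ • v with he
  have he1 : ‖e‖ = 1 := by rw [he, norm_smul, norm_inv, norm_norm, inv_mul_cancel₀ hv'.ne']
  have hve : v = ‖v‖ • e := by rw [he, smul_inv_smul₀ hv'.ne']
  have key := volume_add_symmSegment_unit he1 hL hc (t := t * ‖v‖) (by positivity)
  have hspan : (ℝ ∙ e) = ℝ ∙ v :=
    Submodule.span_singleton_smul_eq (IsUnit.mk0 _ (inv_ne_zero hv'.ne')) v
  have hvol : volume (hyperProj e '' L) = volume (hyperProj v '' L) := by
    have hgen : ∀ W W' : Submodule ℝ E, W = W' → volume (W.orthogonalProjectionOnto '' L) =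
        volume (W'.orthogonalProjectionOnto '' L) := by rintro W _ rfl; rfl
    exact hgen _ _ (by rw [hspan])
  rw [smul_symmSegment, measureReal_def, hve, smul_smul, key, ENNReal.toReal_add
    hL.measure_ne_top (ENNReal.mul_ne_top ENNReal.ofReal_ne_top
      (hL.image (hyperProj e).continuous).measure_ne_top), ENNReal.toReal_mul,
    ENNReal.toReal_ofReal (by positivity), ← hve, segmentRate, hvol]
  simp only [measureReal_def]
  ring

end SegmentVolume

/-! ### Zonotopes given by lists of vectors -/

section Zonotope

variable {E : Type*} [NormedAddCommGroup E] [InnerProductSpace ℝ E]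

/-- The zonotope `∑ [-vᵢ, vᵢ]` of a list of vectors. -/
def zonotope {F : Type*} [AddCommGroup F] [Module ℝ F] (l : List F) : Set F :=
  (l.map symmSegment).sum

theorem zonotope_cons {F : Type*} [AddCommGroup F] [Module ℝ F] (v : F) (l : List F) :
    zonotope (v :: l) = symmSegment v + zonotope l := by
  simp [zonotope]

theorem isCompact_zonotope (l : List E) : IsCompact (zonotope l) := by
  induction l with
  | nil => exact isCompact_singleton
  | cons v l ih => rw [zonotope_cons]; exact (isCompact_symmSegment v).add ih

theorem convex_zonotope (l : List E) : Convex ℝ (zonotope l) := by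
  induction l with
  | nil => exact convex_singleton 0
  | cons v l ih => rw [zonotope_cons]; exact (convex_segment _ _).add ih

theorem zero_mem_zonotope (l : List E) : (0 : E) ∈ zonotope l := by
  induction l with
  | nil => exact mem_singleton 0
  | cons v l ih =>
    rw [zonotope_cons, symmSegment_eq_image]
    exact ⟨0, ⟨0, by simp, by simp⟩, 0, ih, by simp⟩

theorem image_zonotope {F : Type*} [AddCommGroup F] [Module ℝ F] (f : E →ₗ[ℝ] F) (l : List E) :
    f '' zonotope l = zonotope (l.map f) := by
  induction l with
  | nil => simp [zonotope, singleton_zero]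
  | cons v l ih =>
    have h := image_segment ℝ f.toAffineMap (-v) v
    simp only [LinearMap.coe_toAffineMap, map_neg] at h
    rw [zonotope_cons, image_add, ih, symmSegment, h, List.map_cons, zonotope_cons]

end Zonotope

/-! ### The volume polynomial of a body plus a dilated zonotope -/

section Expansion

open Polynomial

variable {E : Type*} [NormedAddCommGroup E] [InnerProductSpace ℝ E] [FiniteDimensional ℝ E]
  [MeasurableSpace E] [BorelSpace E]

/-- The mixed rate of growth of the volume of `L + s[-v,v] + t[-w,w]`. -/
noncomputable def segmentRate₂ (L : Set E) (v w : E) : ℝ :=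
  2 * ‖v‖ * segmentRate (hyperProj v '' L) (hyperProj v w)

theorem segmentRate₂_nonneg (L : Set E) (v w : E) : 0 ≤ segmentRate₂ L v w :=
  mul_nonneg (by positivity) (segmentRate_nonneg _ _)

/-- The sum of the mixed rates over all pairs of entries of a list. -/
noncomputable def pairRate (L : Set E) : List E → ℝ
  | [] => 0
  | v :: l => pairRate L l + (l.map (segmentRate₂ L v)).sum

/-- Splitting off `v`, the volume is that of `L + tZ` plus `2t‖v‖` times the volume of its
projection, and this projection is again a convex body plus a dilated zonotope with fewer
generators, in the hyperplane `vᗮ`. Hence the induction on the number of generators runs over all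
spaces at once. -/
theorem exists_polynomial_volume_add_zonotope {E : Type*} [NormedAddCommGroup E]
    [InnerProductSpace ℝ E] [FiniteDimensional ℝ E] [MeasurableSpace E] [BorelSpace E]
    (l : List E) {L : Set E} (hL : IsCompact L) (hc : Convex ℝ L) :
    ∃ p : ℝ[X], p.natDegree ≤ Module.finrank ℝ E ∧
      (∀ t : ℝ, 0 ≤ t → volume.real (L + t • zonotope l) = p.eval t) ∧
      p.coeff 0 = volume.real L ∧ p.coeff 1 = (l.map (segmentRate L)).sum ∧
      p.coeff 2 = pairRate L l := by
  induction hl : l.length generalizing E with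
  | zero =>
    obtain rfl := List.length_eq_zero_iff.1 hl
    refine ⟨C (volume.real L), by simp, fun t _ => ?_, by simp, by simp,
      by simp [pairRate]⟩
    simp [zonotope]
  | succ N ih =>
    obtain ⟨v, l, rfl⟩ := List.exists_cons_of_length_eq_add_one hl
    have hN : l.length = N := by simpa using hl
    obtain ⟨p, hpd, hp, hp0, hp1, hp2⟩ := ih l hL hc hN
    obtain ⟨q, hqd, hq, hq0, hq1, -⟩ := ih (l.map (hyperProj v))
      (hL.image (hyperProj v).continuous) (hc.linear_image (hyperProj v).toLinearMap)
      (by simpa using hN)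
    refine ⟨p + X * (C (2 * ‖v‖) * q), ?_, fun t ht => ?_, ?_, ?_, ?_⟩
    -- The factor `X` is paid for by the dimension lost in `vᗮ`; if `v = 0` no dimension is lost,
    -- but the coefficient `2 * ‖v‖` is zero.
    · refine (natDegree_add_le _ _).trans (max_le hpd ?_)
      rcases eq_or_ne v 0 with rfl | hv
      · simp
      · have hfr := Submodule.finrank_add_finrank_orthogonal (ℝ ∙ v)
        rw [finrank_span_singleton hv] at hfr
        refine natDegree_mul_le.trans ?_
        rw [natDegree_X]
        have := natDegree_C_mul_le (2 * ‖v‖) q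
        omega
    · have hZ := isCompact_zonotope l
      have hZ' := convex_zonotope l
      rw [zonotope_cons, smul_add, add_comm (t • symmSegment v), ← add_assoc,
        volume_add_smul_symmSegment (hL.add (hZ.smul t)) (hc.add (hZ'.smul t)) v ht, hp t ht,
        segmentRate]
      have : hyperProj v '' (L + t • zonotope l) =
          hyperProj v '' L + t • zonotope (l.map (hyperProj v)) := by
        have h := image_zonotope (hyperProj v).toLinearMap l
        simp only [ContinuousLinearMap.coe_coe] at h
        rw [image_add, image_smul_set, h]
      rw [this, hq t ht]
      simp
    · simp [hp0]
    · rw [coeff_add, coeff_X_mul _ 0, coeff_C_mul, hq0]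
      simp [hp1, segmentRate, add_comm]
    · rw [coeff_add, coeff_X_mul _ 1, coeff_C_mul, hq1, hp2, pairRate]
      rw [← List.sum_map_mul_left]
      simp only [List.map_map]
      rfl

end Expansion

/-! ### Finiteness of the surface area measure -/

section SurfaceArea

variable {n : ℕ} {K : Set (Rn n)}

/-- The points of `K` with an outer unit normal making an angle less than `π / 3` with `e`. -/
def normalCap (K : Set (Rn n)) (e : Rn n) : Set (Rn n) :=
  {x | x ∈ K ∧ ∃ u, IsOuterUnitNormal K x u ∧ 1 / 2 < ⟪u, e⟫_ℝ}

/-- Let `s - r` be the `e`-component of `x - y` and `d` the distance of the projections. The normal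
`u` at `x` satisfies `⟪u, x - y⟫ ≥ 0` and the normal `w` at `y` satisfies `⟪w, x - y⟫ ≤ 0`. As both
have `e`-component above `1/2`, this forces `|s - r| ≤ 2d`. -/
theorem dist_le_of_mem_normalCap {e x y : Rn n} (he : ‖e‖ = 1) (hx : x ∈ normalCap K e)
    (hy : y ∈ normalCap K e) : dist x y ≤ 3 * dist (hyperProj e x) (hyperProj e y) := by
  obtain ⟨hxK, u, ⟨hu1, hu⟩, hue⟩ := hx
  obtain ⟨hyK, w, ⟨hw1, hw⟩, hwe⟩ := hy
  obtain ⟨s, hs⟩ := exists_smul_add_hyperProj e x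
  obtain ⟨r, hr⟩ := exists_smul_add_hyperProj e y
  set d := dist (hyperProj e x) (hyperProj e y) with hd
  have hd' : d = ‖(hyperProj e x : Rn n) - hyperProj e y‖ := by
    rw [hd, Subtype.dist_eq, dist_eq_norm]
  have hdec : x - y = (s - r) • e + ((hyperProj e x : Rn n) - hyperProj e y) := by
    nth_rewrite 1 [hs]; nth_rewrite 1 [hr]; module
  have h1 := hu y hyK
  have h2 := hw x hxK
  have e1 : ⟪u, x⟫_ℝ - ⟪u, y⟫_ℝ =
      (s - r) * ⟪u, e⟫_ℝ + ⟪u, (hyperProj e x : Rn n) - hyperProj e y⟫_ℝ := by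
    rw [← inner_sub_right, hdec, inner_add_right, inner_smul_right]
  have e2 : ⟪w, x⟫_ℝ - ⟪w, y⟫_ℝ =
      (s - r) * ⟪w, e⟫_ℝ + ⟪w, (hyperProj e x : Rn n) - hyperProj e y⟫_ℝ := by
    rw [← inner_sub_right, hdec, inner_add_right, inner_smul_right]
  have b1 := abs_le.1 (abs_real_inner_le_norm u ((hyperProj e x : Rn n) - hyperProj e y))
  have b2 := abs_le.1 (abs_real_inner_le_norm w ((hyperProj e x : Rn n) - hyperProj e y))
  rw [hu1, one_mul, ← hd'] at b1
  rw [hw1, one_mul, ← hd'] at b2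
  have hsr : |s - r| ≤ 2 * d := by
    rw [abs_le]
    constructor
    · by_contra! h
      nlinarith [b1.2]
    · by_contra! h
      nlinarith [b2.1]
  calc dist x y = ‖x - y‖ := dist_eq_norm _ _
    _ ≤ ‖(s - r) • e‖ + d := by rw [hdec, hd']; exact norm_add_le _ _
    _ ≤ 3 * d := by rw [norm_smul, he, mul_one, Real.norm_eq_abs]; linarith

/-- The cap is a Lipschitz graph over a bounded subset of the hyperplane `eᗮ`. -/
theorem measure_normalCap_lt_top (hK : IsCompact K) {e : Rn n} (he : ‖e‖ = 1) :
    (μHE[n - 1] : Measure (Rn n)) (normalCap K e) < ⊤ := by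
  have hanti : AntilipschitzWith 3 (fun x : normalCap K e => hyperProj e (x : Rn n)) :=
    AntilipschitzWith.of_le_mul_dist fun x y => dist_le_of_mem_normalCap he x.2 y.2
  have h := hanti.le_hausdorffMeasure_image (d := ((n - 1 : ℕ) : ℝ)) (by positivity) univ
  rw [← isometry_subtype_coe.hausdorffMeasure_image (Or.inl (by positivity)), image_univ,
    Subtype.range_coe, image_univ] at h
  have hsub : (range fun x : normalCap K e => hyperProj e (x : Rn n)) ⊆ hyperProj e '' K := by
    rintro _ ⟨x, rfl⟩
    exact ⟨x, x.2.1, rfl⟩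
  have hfr : Module.finrank ℝ (ℝ ∙ e)ᗮ = n - 1 := by
    have := Submodule.finrank_add_finrank_orthogonal (ℝ ∙ e)
    rw [finrank_span_singleton (norm_ne_zero_iff.1 (he ▸ one_ne_zero)),
      finrank_euclideanSpace_fin] at this
    omega
  have hfin : (μHE[n - 1] : Measure (ℝ ∙ e)ᗮ) (hyperProj e '' K) < ⊤ := by
    rw [← hfr, InnerProductSpace.euclideanHausdorffMeasure_eq_volume]
    exact (hK.image (hyperProj e).continuous).measure_lt_top
  -- The Lipschitz estimate concerns the unnormalised Hausdorff measure, which differs by a finite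
  -- nonzero factor.
  rw [Measure.euclideanHausdorffMeasure_def, Measure.smul_apply, ENNReal.smul_def] at hfin ⊢
  have hfin' := ENNReal.lt_top_of_mul_ne_top_right hfin.ne
    (by exact_mod_cast Measure.addHaarScalarFactor_volume_hausdorffMeasure_ne_zero _)
  refine ENNReal.mul_lt_top ENNReal.coe_lt_top (h.trans_lt (ENNReal.mul_lt_top ?_
    ((measure_mono hsub).trans_lt hfin')))
  exact ENNReal.rpow_lt_top_of_nonneg (by positivity) (by simp)

theorem measure_regularBoundary_lt_top (hK : IsCompact K) :
    (μHE[n - 1] : Measure (Rn n)) (regularBoundary K) < ⊤ := by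
  -- Radius `1` suits the caps: unit vectors with `‖u - e‖ < 1` have `⟪u, e⟫ > 1/2`.
  obtain ⟨T, hT, hfin, hcov⟩ := (isCompact_sphere (0 : Rn n) 1).finite_cover_balls one_pos
  refine (measure_mono ?_).trans_lt
    (measure_biUnion_lt_top (s := T) (f := normalCap K) hfin fun e he =>
      measure_normalCap_lt_top hK (by simpa using hT he))
  rintro x ⟨hx, u, hu, -⟩
  obtain ⟨e, he, hue⟩ := mem_iUnion₂.1 (hcov (by simpa using hu.1 : u ∈ Metric.sphere (0 : Rn n) 1))
  refine mem_iUnion₂.2 ⟨e, he, hK.isClosed.frontier_subset hx, u, hu, ?_⟩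
  have he1 : ‖e‖ = 1 := by simpa using hT he
  rw [Metric.mem_ball, dist_eq_norm] at hue
  have h := norm_sub_sq_real u e
  rw [hu.1, he1] at h
  nlinarith [norm_nonneg (u - e)]

theorem isFiniteMeasure_surfaceAreaMeasure (hK : IsCompact K) :
    IsFiniteMeasure (surfaceAreaMeasure K) := by
  refine ⟨?_⟩
  rw [surfaceAreaMeasure, Measure.map_apply (measurable_gaussMap hK) MeasurableSet.univ,
    preimage_univ, Measure.restrict_apply_univ]
  exact measure_regularBoundary_lt_top hK

theorem ae_norm_eq_one_surfaceAreaMeasure (hK : IsCompact K) :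
    ∀ᵐ u ∂surfaceAreaMeasure K, ‖u‖ = 1 := by
  rw [surfaceAreaMeasure, ae_map_iff (measurable_gaussMap hK).aemeasurable
    (measurableSet_eq_fun (by fun_prop) (by fun_prop))]
  refine (ae_restrict_mem (measurableSet_regularBoundary hK)).mono fun x hx => ?_
  rw [gaussMap, dif_pos hx]
  exact hx.2.choose_spec.1.1

end SurfaceArea

/-! ### Limits of polynomials, and mixed volumes as coefficients -/

section Polynomials

open Polynomial

/-- By Lagrange interpolation at `0, …, d`, every coefficient and every value of `p k` is a fixed
linear combination of its values at these nodes. -/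
theorem exists_polynomial_limit {d : ℕ} {p : ℕ → ℝ[X]} (hd : ∀ k, (p k).natDegree ≤ d) {f : ℝ → ℝ}
    (hf : ∀ t, 0 ≤ t → Tendsto (fun k => (p k).eval t) atTop (𝓝 (f t))) :
    ∃ q : ℝ[X], (∀ t, 0 ≤ t → f t = q.eval t) ∧
      ∀ j, Tendsto (fun k => (p k).coeff j) atTop (𝓝 (q.coeff j)) := by
  let s : Finset ℕ := Finset.range (d + 1)
  let x : ℕ → ℝ := fun i => i
  have hx : InjOn x s := Nat.cast_injective.injOn
  have hp : ∀ k, p k = Lagrange.interpolate s x fun i => (p k).eval (x i) := fun k => by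
    refine Lagrange.eq_interpolate hx ((degree_le_natDegree).trans_lt ?_)
    rw [Finset.card_range]
    exact_mod_cast Nat.lt_succ_of_le (hd k)
  have hcoeff : ∀ (r : ℕ → ℝ) j, (Lagrange.interpolate s x r).coeff j =
      ∑ i ∈ s, r i * (Lagrange.basis s x i).coeff j := fun r j => by
    simp [Lagrange.interpolate_apply]
  have heval : ∀ (r : ℕ → ℝ) t, (Lagrange.interpolate s x r).eval t =
      ∑ i ∈ s, r i * (Lagrange.basis s x i).eval t := fun r t => by
    simp [Lagrange.interpolate_apply, eval_finsetSum]
  refine ⟨Lagrange.interpolate s x fun i => f (x i), fun t ht => ?_, fun j => ?_⟩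
  · refine tendsto_nhds_unique (hf t ht) ?_
    rw [heval]
    simp_rw [fun k => (congrArg (eval t) (hp k)).trans (heval _ t)]
    exact tendsto_finsetSum _ fun i _ => (hf (x i) (Nat.cast_nonneg i)).mul_const _
  · rw [hcoeff]
    simp_rw [fun k => (congrArg (coeff · j) (hp k)).trans (hcoeff _ j)]
    exact tendsto_finsetSum _ fun i _ => (hf (x i) (Nat.cast_nonneg i)).mul_const _

theorem mixedVol_eq_coeff {n : ℕ} {K M : Set (Rn n)} {q : ℝ[X]}
    (h : ∀ t : ℝ, 0 ≤ t → volume.real (K + t • M) = q.eval t) (k : ℕ) :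
    mixedVol k K M = ((n - k).factorial : ℝ) / (n.factorial : ℝ) * (k.factorial * q.coeff k) := by
  have h1 : iteratedDerivWithin k (fun t : ℝ => volume.real (K + t • M)) (Ici 0) 0 =
      iteratedDerivWithin k (fun t : ℝ => q.eval t) (Ici 0) 0 :=
    iteratedDerivWithin_congr (fun t ht => h t ht) (mem_Ici.2 le_rfl)
  have h2 : ContDiff ℝ k fun t : ℝ => q.eval t := by
    simpa [Polynomial.coe_aeval_eq_eval] using q.contDiff_aeval (𝕜 := ℝ) k
  have h3 : ∀ j, deriv^[j] (fun t : ℝ => q.eval t) = fun t => (derivative^[j] q).eval t := fun j => by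
    induction j with
    | zero => rfl
    | succ j ih =>
      rw [Function.iterate_succ_apply', Function.iterate_succ_apply', ih]
      ext t
      exact Polynomial.deriv _
  rw [mixedVol, h1, iteratedDerivWithin_eq_iteratedDeriv (uniqueDiffOn_Ici 0)
    h2.contDiffAt (mem_Ici.2 le_rfl), iteratedDeriv_eq_iterate, h3]
  simp only
  rw [← coeff_zero_eq_eval_zero, coeff_iterate_derivative]
  simp [Nat.descFactorial_self]

end Polynomials

/-! ### Support functions -/

section SupportFunctions

variable {n : ℕ} {K M Z : Set (Rn n)}

theorem inner_le_supportFn (hK : IsCompact K) {y : Rn n} (hy : y ∈ K) (u : Rn n) :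
    ⟪u, y⟫_ℝ ≤ supportFn K u :=
  le_csSup (hK.image (by fun_prop)).bddAbove (mem_image_of_mem _ hy)

theorem continuous_supportFn (hK : IsCompact K) : Continuous (supportFn K) :=
  hK.continuous_sSup (f := fun u y : Rn n => ⟪u, y⟫_ℝ) (by fun_prop)

theorem supportFn_nonneg (hK : IsCompact K) (h0 : 0 ∈ K) (u : Rn n) : 0 ≤ supportFn K u := by
  simpa using inner_le_supportFn hK h0 u

theorem le_supportFn_of_closedBall_subset (hK : IsCompact K) {r : ℝ} (hr : 0 ≤ r)
    (hKr : Metric.closedBall 0 r ⊆ K) {u : Rn n} (hu : ‖u‖ = 1) : r ≤ supportFn K u := by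
  have h := inner_le_supportFn hK (hKr (by simp [norm_smul, hu, abs_of_nonneg hr] :
    r • u ∈ Metric.closedBall 0 r)) u
  rwa [inner_smul_right, real_inner_self_eq_norm_sq, hu, one_pow, mul_one] at h

theorem supportFn_le_of_subset_add (hM : IsCompact M) (hZ : Z.Nonempty) {ε : ℝ}
    (h : Z ⊆ M + Metric.closedBall 0 ε) {u : Rn n} (hu : ‖u‖ = 1) :
    supportFn Z u ≤ supportFn M u + ε := by
  refine csSup_le (hZ.image _) ?_
  rintro _ ⟨z, hz, rfl⟩
  obtain ⟨m, hm, b, hb, rfl⟩ := h hz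
  have h1 := inner_le_supportFn hM hm u
  have h2 := real_inner_le_norm u b
  rw [hu, one_mul] at h2
  simp only [inner_add_right]
  have := mem_closedBall_zero_iff.1 hb
  linarith

theorem supportFn_add (hK : IsCompact K) (hK0 : K.Nonempty) (hM : IsCompact M) (hM0 : M.Nonempty)
    (u : Rn n) : supportFn (K + M) u = supportFn K u + supportFn M u := by
  unfold supportFn
  have : (fun y => ⟪u, y⟫_ℝ) '' (K + M) =
      (fun y => ⟪u, y⟫_ℝ) '' K + (fun y => ⟪u, y⟫_ℝ) '' M :=
    image_add (innerSL ℝ u)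
  rw [this, csSup_add (hK0.image _) (hK.image (by fun_prop)).bddAbove (hM0.image _)
    (hM.image (by fun_prop)).bddAbove]

theorem supportFn_symmSegment (v u : Rn n) : supportFn (symmSegment v) u = |⟪u, v⟫_ℝ| := by
  refine IsGreatest.csSup_eq ⟨?_, ?_⟩
  · rcases abs_cases ⟪u, v⟫_ℝ with ⟨h, -⟩ | ⟨h, -⟩
    · exact ⟨v, right_mem_segment _ _ _, h.symm⟩
    · exact ⟨-v, left_mem_segment _ _ _, by simp [h]⟩
  · rintro _ ⟨y, hy, rfl⟩
    rw [symmSegment_eq_image] at hy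
    obtain ⟨s, hs, rfl⟩ := hy
    simp only [inner_smul_right]
    calc s * ⟪u, v⟫_ℝ ≤ |s * ⟪u, v⟫_ℝ| := le_abs_self _
      _ = |s| * |⟪u, v⟫_ℝ| := abs_mul _ _
      _ ≤ 1 * |⟪u, v⟫_ℝ| := by gcongr; exact abs_le.2 hs
      _ = _ := one_mul _

theorem supportFn_zonotope (l : List (Rn n)) (u : Rn n) :
    supportFn (zonotope l) u = (l.map fun v => |⟪u, v⟫_ℝ|).sum := by
  induction l with
  | nil => simp [zonotope, supportFn, ← singleton_zero]
  | cons v l ih =>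
    rw [zonotope_cons, supportFn_add (isCompact_symmSegment v) ⟨v, right_mem_segment _ _ _⟩
      (isCompact_zonotope l) ⟨0, zero_mem_zonotope l⟩, ih, supportFn_symmSegment]
    simp

end SupportFunctions

/-! ### Continuity of volumes and integrals under Hausdorff convergence -/

section HausdorffConvergence

variable {n : ℕ} {K M : Set (Rn n)}

/-- Convergence of a sequence of sets in the Hausdorff metric, in terms of Minkowski sums. -/
def TendstoHausdorff (Z : ℕ → Set (Rn n)) (M : Set (Rn n)) : Prop :=
  ∃ ε : ℕ → ℝ, Tendsto ε atTop (𝓝 0) ∧ ∀ k, 0 ≤ ε k ∧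
    Z k ⊆ M + Metric.closedBall 0 (ε k) ∧ M ⊆ Z k + Metric.closedBall 0 (ε k)

theorem IsSymmConvexBody.exists_closedBall_subset (hK : IsSymmConvexBody K) :
    ∃ r : ℝ, 0 < r ∧ Metric.closedBall 0 r ⊆ K := by
  obtain ⟨x, hx⟩ := hK.interior_nonempty
  obtain ⟨r, hr, h⟩ := Metric.nhds_basis_closedBall.mem_iff.1 (mem_interior_iff_mem_nhds.1 hx)
  refine ⟨r, hr, fun z hz => ?_⟩
  have hz' : ‖z‖ ≤ r := by simpa using hz
  -- By symmetry, `z` is the midpoint of the two points `x + z` and `-(x - z)` of `K`.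
  have h1 : x + z ∈ K := h (by simpa using hz')
  have h2 : -(x - z) ∈ K := hK.symm _ (h (by simpa using hz'))
  have := hK.convex h1 h2 (by norm_num : (0 : ℝ) ≤ 1 / 2) (by norm_num : (0 : ℝ) ≤ 1 / 2)
    (by norm_num)
  convert this using 1
  module

theorem smul_subset_smul_add {A B : Set (Rn n)} {ε t : ℝ} (ht : 0 ≤ t)
    (h : A ⊆ B + Metric.closedBall 0 ε) :
    t • A ⊆ t • B + Metric.closedBall 0 (t * ε) := by
  rintro _ ⟨a, ha, rfl⟩
  obtain ⟨b, hb, c, hc, rfl⟩ := h ha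
  refine ⟨t • b, smul_mem_smul_set hb, t • c, ?_, by simp⟩
  rw [mem_closedBall_zero_iff] at hc ⊢
  rw [norm_smul, Real.norm_of_nonneg ht]
  gcongr

theorem TendstoHausdorff.smul {Z : ℕ → Set (Rn n)} (h : TendstoHausdorff Z M) {t : ℝ}
    (ht : 0 ≤ t) : TendstoHausdorff (fun k => t • Z k) (t • M) := by
  obtain ⟨ε, hε, h⟩ := h
  exact ⟨fun k => t * ε k, by simpa using hε.const_mul t, fun k =>
    ⟨mul_nonneg ht (h k).1, smul_subset_smul_add ht (h k).2.1, smul_subset_smul_add ht (h k).2.2⟩⟩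

/-- The error ball of radius `ε` lies in `(ε / r) • K`, hence in `(ε / r) • (K + M)` because `0 ∈
M`; convexity adds up the dilates. An additive error thus becomes a dilation, whose effect on volume
is explicit. -/
theorem add_subset_smul_add (hK : Convex ℝ K) {r : ℝ} (hr : 0 < r)
    (hKr : Metric.closedBall 0 r ⊆ K) (hM : Convex ℝ M) (h0 : 0 ∈ M) {Z : Set (Rn n)} {ε : ℝ}
    (hε : 0 ≤ ε) (h : Z ⊆ M + Metric.closedBall 0 ε) :
    K + Z ⊆ (1 + ε / r) • (K + M) := by
  rw [(hK.add hM).add_smul zero_le_one (by positivity), one_smul]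
  rintro _ ⟨k, hk, z, hz, rfl⟩
  obtain ⟨m, hm, b, hb, rfl⟩ := h hz
  have hb' : b ∈ (ε / r) • Metric.closedBall (0 : Rn n) r := by
    rw [_root_.smul_closedBall _ _ hr.le, smul_zero, Real.norm_of_nonneg (by positivity),
      div_mul_cancel₀ _ hr.ne']
    exact hb
  obtain ⟨c, hc, rfl⟩ := hb'
  refine ⟨k + m, add_mem_add hk hm, (ε / r) • c, smul_mem_smul_set ⟨c, hKr hc, 0, h0, by simp⟩, ?_⟩
  simp only
  abel

theorem volume_add_le (hK : Convex ℝ K) (hKc : IsCompact K) {r : ℝ} (hr : 0 < r)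
    (hKr : Metric.closedBall 0 r ⊆ K) (hM : Convex ℝ M) (hMc : IsCompact M) (h0 : 0 ∈ M)
    {Z : Set (Rn n)} {ε : ℝ} (hε : 0 ≤ ε) (h : Z ⊆ M + Metric.closedBall 0 ε) :
    volume.real (K + Z) ≤ (1 + ε / r) ^ n * volume.real (K + M) := by
  have hc : IsCompact ((1 + ε / r) • (K + M)) := (hKc.add hMc).smul _
  refine (measureReal_mono (add_subset_smul_add hK hr hKr hM h0 hε h) hc.measure_ne_top).trans ?_
  rw [measureReal_def, Measure.addHaar_smul, ENNReal.toReal_mul, finrank_euclideanSpace_fin,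
    ENNReal.toReal_ofReal (abs_nonneg _), abs_of_nonneg (by positivity), measureReal_def]

/-- `volume_add_le`, used once in each direction, squeezes the ratio of the two volumes between `(1
+ ε / r) ^ n` and its inverse. -/
theorem TendstoHausdorff.tendsto_volume_add {Z : ℕ → Set (Rn n)} (h : TendstoHausdorff Z M)
    (hK : IsSymmConvexBody K) (hM : Convex ℝ M) (hMc : IsCompact M) (h0 : 0 ∈ M)
    (hZ : ∀ k, Convex ℝ (Z k)) (hZc : ∀ k, IsCompact (Z k)) (hZ0 : ∀ k, 0 ∈ Z k) :
    Tendsto (fun k => volume.real (K + Z k)) atTop (𝓝 (volume.real (K + M))) := by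
  obtain ⟨ε, hε, h⟩ := h
  obtain ⟨r, hr, hKr⟩ := hK.exists_closedBall_subset
  have hlim : Tendsto (fun k => (1 + ε k / r) ^ n) atTop (𝓝 1) := by
    simpa using ((hε.div_const r).const_add 1).pow n
  refine tendsto_of_tendsto_of_tendsto_of_le_of_le
    (g := fun k => ((1 + ε k / r) ^ n)⁻¹ * volume.real (K + M))
    (h := fun k => (1 + ε k / r) ^ n * volume.real (K + M)) ?_ ?_ (fun k => ?_) (fun k => ?_)
  · simpa using (hlim.inv₀ one_ne_zero).mul_const (volume.real (K + M))
  · simpa using hlim.mul_const (volume.real (K + M))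
  · have h1 := volume_add_le hK.convex hK.isCompact hr hKr (hZ k) (hZc k) (hZ0 k) (h k).1 (h k).2.2
    have := (h k).1
    have hpos : 0 < (1 + ε k / r) ^ n := by positivity
    simp only
    rwa [inv_mul_le_iff₀ hpos]
  · exact volume_add_le hK.convex hK.isCompact hr hKr hM hMc h0 (h k).1 (h k).2.1

theorem TendstoHausdorff.tendsto_supportFn {Z : ℕ → Set (Rn n)} (h : TendstoHausdorff Z M)
    (hMc : IsCompact M) (h0 : 0 ∈ M) (hZc : ∀ k, IsCompact (Z k)) (hZ0 : ∀ k, 0 ∈ Z k)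
    {u : Rn n} (hu : ‖u‖ = 1) :
    Tendsto (fun k => supportFn (Z k) u) atTop (𝓝 (supportFn M u)) := by
  obtain ⟨ε, hε, h⟩ := h
  refine tendsto_of_tendsto_of_tendsto_of_le_of_le
    (g := fun k => supportFn M u - ε k) (h := fun k => supportFn M u + ε k)
    (by simpa using hε.const_sub (supportFn M u)) (by simpa using hε.const_add (supportFn M u))
    (fun k => ?_) (fun k => ?_)
  · have := supportFn_le_of_subset_add (hZc k) ⟨0, h0⟩ (h k).2.2 hu
    simp only
    linarith
  · exact supportFn_le_of_subset_add hMc ⟨0, hZ0 k⟩ (h k).2.1 hu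

theorem TendstoHausdorff.exists_supportFn_le {Z : ℕ → Set (Rn n)} (h : TendstoHausdorff Z M)
    (hMc : IsCompact M) (hZ0 : ∀ k, 0 ∈ Z k) :
    ∃ C : ℝ, ∀ k u, ‖u‖ = 1 → supportFn (Z k) u ≤ C := by
  obtain ⟨ε, hε, h⟩ := h
  obtain ⟨C, hC⟩ := hε.bddAbove_range
  obtain ⟨R, hR⟩ := (isCompact_sphere (0 : Rn n) 1).exists_bound_of_continuousOn
    (continuous_supportFn hMc).continuousOn
  refine ⟨R + C, fun k u hu => ?_⟩
  have h1 := supportFn_le_of_subset_add hMc ⟨0, hZ0 k⟩ (h k).2.1 hu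
  have h2 := (le_abs_self _).trans (hR u (by simpa using hu))
  have h3 := hC (mem_range_self k)
  linarith

/-- Integrals of products of support functions against `h_K⁻¹ dS_K` are continuous. -/
theorem tendsto_integral_supportFn_mul (hK : IsSymmConvexBody K) {Z Z' : ℕ → Set (Rn n)}
    {M' : Set (Rn n)} (h : TendstoHausdorff Z M) (h' : TendstoHausdorff Z' M')
    (hMc : IsCompact M) (h0 : 0 ∈ M) (hZc : ∀ k, IsCompact (Z k)) (hZ0 : ∀ k, 0 ∈ Z k)
    (hMc' : IsCompact M') (h0' : 0 ∈ M') (hZc' : ∀ k, IsCompact (Z' k)) (hZ0' : ∀ k, 0 ∈ Z' k) :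
    Tendsto (fun k => ∫ u, supportFn (Z k) u * supportFn (Z' k) u / supportFn K u
      ∂surfaceAreaMeasure K) atTop
      (𝓝 (∫ u, supportFn M u * supportFn M' u / supportFn K u ∂surfaceAreaMeasure K)) := by
  have := isFiniteMeasure_surfaceAreaMeasure hK.isCompact
  obtain ⟨r, hr, hKr⟩ := hK.exists_closedBall_subset
  obtain ⟨C, hC⟩ := h.exists_supportFn_le hMc hZ0
  obtain ⟨C', hC'⟩ := h'.exists_supportFn_le hMc' hZ0'
  refine tendsto_integral_of_dominated_convergence (fun _ => C * C' / r) (fun k => ?_)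
    (integrable_const _) (fun k => ?_) ?_
  · exact (((continuous_supportFn (hZc k)).measurable.mul
      (continuous_supportFn (hZc' k)).measurable).div
      (continuous_supportFn hK.isCompact).measurable).aestronglyMeasurable
  · filter_upwards [ae_norm_eq_one_surfaceAreaMeasure hK.isCompact] with u hu
    have h1 := supportFn_nonneg (hZc k) (hZ0 k) u
    have h2 := supportFn_nonneg (hZc' k) (hZ0' k) u
    have h3 := le_supportFn_of_closedBall_subset hK.isCompact hr.le hKr hu
    have h4 := hC k u hu
    have h5 := hC' k u hu
    rw [Real.norm_of_nonneg (div_nonneg (mul_nonneg h1 h2) (hr.le.trans h3))]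
    have h6 := h1.trans h4
    have h7 := h2.trans h5
    have h8 : 0 ≤ C * C' := mul_nonneg h6 h7
    gcongr
  · filter_upwards [ae_norm_eq_one_surfaceAreaMeasure hK.isCompact] with u hu
    exact ((h.tendsto_supportFn hMc h0 hZc hZ0 hu).mul
      (h'.tendsto_supportFn hMc' h0' hZc' hZ0' hu)).div_const _

end HausdorffConvergence

/-! ### Growth rates as volumes of projections -/

section ProjectionVolumes

variable {n : ℕ} {K : Set (Rn n)}

theorem projSet_eq_image (K : Set (Rn n)) (H : Submodule ℝ (Rn n)) :
    projSet K H = H.starProjection '' K := by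
  ext x
  constructor
  · rintro ⟨hx, y, hy, hxy⟩
    refine ⟨x + y, hxy, ?_⟩
    rw [map_add, Submodule.starProjection_eq_self_iff.2 hx,
      (Submodule.starProjection_apply_eq_zero_iff _).2 hy, add_zero]
  · rintro ⟨k, hk, rfl⟩
    exact ⟨H.starProjection_apply_mem k, k - H.starProjection k,
      H.sub_starProjection_mem_orthogonal k, by simpa using hk⟩

theorem projVol_eq_volume {V : Type*} [NormedAddCommGroup V] [InnerProductSpace ℝ V]
    [FiniteDimensional ℝ V] [MeasurableSpace V] [BorelSpace V] {k : ℕ}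
    (hV : Module.finrank ℝ V = k) {H : Submodule ℝ (Rn n)} {f : V → Rn n} (hf : Isometry f)
    {S : Set V} (hS : f '' S = projSet K H) : projVol k K H = volume.real S := by
  rw [projVol, ← hS, measureReal_def, hf.euclideanHausdorffMeasure_image, ← hV,
    InnerProductSpace.euclideanHausdorffMeasure_eq_volume, measureReal_def]

theorem finrank_orthogonal_singleton {E : Type*} [NormedAddCommGroup E] [InnerProductSpace ℝ E]
    [FiniteDimensional ℝ E] {v : E} (hv : v ≠ 0) :
    Module.finrank ℝ (ℝ ∙ v)ᗮ = Module.finrank ℝ E - 1 := by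
  have := Submodule.finrank_add_finrank_orthogonal (ℝ ∙ v)
  rw [finrank_span_singleton hv] at this
  omega

theorem segmentRate_eq_projVol {v : Rn n} (hv : v ≠ 0) :
    segmentRate K v = 2 * ‖v‖ * projVol (n - 1) K (Submodule.span ℝ {v})ᗮ := by
  rw [segmentRate, projVol_eq_volume (by rw [finrank_orthogonal_singleton hv,
    finrank_euclideanSpace_fin]) isometry_subtype_coe (S := hyperProj v '' K)]
  rw [projSet_eq_image, image_image]
  rfl

/-- The projection of `w` along `v` is `w - b • v`, so the two steps subtract only elements of the
span and leave a vector orthogonal to both `v` and `w`. This matches the iterated projections in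
`segmentRate₂` with the projection in the hypothesis. -/
theorem hyperProj_hyperProj_eq_starProjection (v w x : Rn n) :
    ((hyperProj (hyperProj v w) (hyperProj v x) : (ℝ ∙ v)ᗮ) : Rn n) =
      (Submodule.span ℝ {v, w})ᗮ.starProjection x := by
  obtain ⟨a, ha⟩ := exists_smul_add_hyperProj v x
  obtain ⟨b, hb⟩ := exists_smul_add_hyperProj v w
  obtain ⟨c, hc⟩ := exists_smul_add_hyperProj (hyperProj v w) (hyperProj v x)
  set y := hyperProj (hyperProj v w) (hyperProj v x)
  have hv : v ∈ Submodule.span ℝ {v, w} := Submodule.subset_span (by simp)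
  have hw : w ∈ Submodule.span ℝ {v, w} := Submodule.subset_span (by simp)
  have hPw : (hyperProj v w : Rn n) = w - b • v := by rw [eq_sub_iff_add_eq', ← hb]
  have hyv : ⟪v, ((y : (ℝ ∙ v)ᗮ) : Rn n)⟫_ℝ = 0 :=
    Submodule.mem_orthogonal_singleton_iff_inner_right.1 (y : (ℝ ∙ v)ᗮ).2
  have hyw : ⟪hyperProj v w, (y : (ℝ ∙ v)ᗮ)⟫_ℝ = 0 :=
    Submodule.mem_orthogonal_singleton_iff_inner_right.1 y.2
  have hx : x - ((y : (ℝ ∙ v)ᗮ) : Rn n) = a • v + c • (w - b • v) := by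
    have hc' : (hyperProj v x : Rn n) = c • (hyperProj v w : Rn n) + ((y : (ℝ ∙ v)ᗮ) : Rn n) :=
      congrArg Subtype.val hc
    nth_rewrite 1 [ha]
    rw [hc', hPw]
    abel
  refine (Submodule.eq_starProjection_of_mem_orthogonal ?_ ?_).symm
  · rw [Submodule.mem_orthogonal]
    intro z hz
    obtain ⟨p, q, rfl⟩ := Submodule.mem_span_pair.1 hz
    rw [Submodule.coe_inner, hPw, inner_sub_left, inner_smul_left, hyv] at hyw
    rw [inner_add_left, inner_smul_left, inner_smul_left, hyv]
    simp at hyw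
    simp [hyw]
  · rw [Submodule.orthogonal_orthogonal, hx]
    exact Submodule.add_mem _ (Submodule.smul_mem _ _ hv)
      (Submodule.smul_mem _ _ (Submodule.sub_mem _ hw (Submodule.smul_mem _ _ hv)))

theorem hyperProj_ne_zero {v w : Rn n} (h : LinearIndependent ℝ ![v, w]) : hyperProj v w ≠ 0 := by
  intro h0
  obtain ⟨b, hb⟩ := exists_smul_add_hyperProj v w
  rw [h0] at hb
  have := (LinearIndependent.pair_iff.1 h) b (-1) (by rw [hb]; simp)
  simpa using this.2

theorem segmentRate₂_eq_projVol {v w : Rn n} (h : LinearIndependent ℝ ![v, w]) :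
    segmentRate₂ K v w =
      4 * ‖v‖ * ‖hyperProj v w‖ * projVol (n - 2) K (Submodule.span ℝ {v, w})ᗮ := by
  have hv : v ≠ 0 := by simpa using h.ne_zero 0
  have hw := hyperProj_ne_zero h
  rw [segmentRate₂, segmentRate, projVol_eq_volume (V := (ℝ ∙ (hyperProj v w))ᗮ) (by
    rw [finrank_orthogonal_singleton hw, finrank_orthogonal_singleton hv,
      finrank_euclideanSpace_fin, Nat.sub_sub]) (isometry_subtype_coe.comp isometry_subtype_coe)
    (S := hyperProj (hyperProj v w) '' (hyperProj v '' K))]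
  · ring
  · rw [projSet_eq_image, image_image, image_image]
    exact image_congr fun x _ => hyperProj_hyperProj_eq_starProjection v w x

theorem norm_hyperProj_of_norm_eq_one {v w : Rn n} (hv : ‖v‖ = 1) (hw : ‖w‖ = 1) :
    ‖hyperProj v w‖ = √(1 - ⟪v, w⟫_ℝ ^ 2) := by
  obtain ⟨b, hb⟩ := exists_smul_add_hyperProj v w
  have hyv : ⟪v, (hyperProj v w : Rn n)⟫_ℝ = 0 :=
    Submodule.mem_orthogonal_singleton_iff_inner_right.1 (hyperProj v w).2
  have hvw : ⟪v, w⟫_ℝ = b := by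
    rw [hb, inner_add_right, inner_smul_right, hyv, real_inner_self_eq_norm_sq, hv]; ring
  have h2 : ‖w‖ ^ 2 = b ^ 2 + ‖hyperProj v w‖ ^ 2 := by
    nth_rewrite 1 [hb]
    rw [norm_add_sq_real, inner_smul_left, hyv, norm_smul, hv, Submodule.norm_coe]
    simp
  rw [hvw, show 1 - b ^ 2 = ‖hyperProj v w‖ ^ 2 by rw [hw] at h2; linarith,
    Real.sqrt_sq (norm_nonneg _)]

end ProjectionVolumes

/-! ### The inequality for arbitrary pairs of vectors -/

section PairInequality

variable {n : ℕ} {K : Set (Rn n)}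

theorem zero_mem_symmSegment (v : Rn n) : (0 : Rn n) ∈ symmSegment v := by
  rw [symmSegment_eq_image]
  exact ⟨0, by simp, by simp⟩

theorem symmSegment_subset_add (v w : Rn n) :
    symmSegment w ⊆ symmSegment v + Metric.closedBall 0 ‖w - v‖ := by
  rw [symmSegment_eq_image, symmSegment_eq_image]
  rintro _ ⟨s, hs, rfl⟩
  refine ⟨s • v, ⟨s, hs, rfl⟩, s • (w - v), ?_, by simp only; module⟩
  rw [mem_closedBall_zero_iff, norm_smul]
  exact mul_le_of_le_one_left (norm_nonneg _) (abs_le.2 hs)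

theorem tendstoHausdorff_symmSegment {w : ℕ → Rn n} {v : Rn n} (h : Tendsto w atTop (𝓝 v)) :
    TendstoHausdorff (fun k => symmSegment (w k)) (symmSegment v) :=
  ⟨fun k => ‖w k - v‖, tendsto_iff_norm_sub_tendsto_zero.1 h, fun k =>
    ⟨norm_nonneg _, symmSegment_subset_add _ _, by
      simp only [norm_sub_rev (w k) v]; exact symmSegment_subset_add _ _⟩⟩

/-- Writing the rate as the difference of the volumes of `K + [-v, v]` and `K` avoids comparing
projections onto varying hyperplanes. -/
theorem tendsto_segmentRate (hK : IsSymmConvexBody K) {w : ℕ → Rn n} {v : Rn n}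
    (h : Tendsto w atTop (𝓝 v)) :
    Tendsto (fun k => segmentRate K (w k)) atTop (𝓝 (segmentRate K v)) := by
  have hrate : ∀ x, segmentRate K x = volume.real (K + symmSegment x) - volume.real K := fun x => by
    have := volume_add_smul_symmSegment hK.isCompact hK.convex x zero_le_one
    rw [one_smul] at this
    linarith
  simp_rw [hrate]
  exact ((tendstoHausdorff_symmSegment h).tendsto_volume_add hK (convex_segment _ _)
    (isCompact_symmSegment _) (zero_mem_symmSegment _) (fun _ => convex_segment _ _)
    (fun _ => isCompact_symmSegment _) (fun _ => zero_mem_symmSegment _)).sub_const _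

theorem span_pair_smul {a b : ℝ} (ha : a ≠ 0) (hb : b ≠ 0) (v w : Rn n) :
    Submodule.span ℝ {a • v, b • w} = Submodule.span ℝ {v, w} := by
  rw [Submodule.span_insert, Submodule.span_insert,
    Submodule.span_singleton_smul_eq ha.isUnit, Submodule.span_singleton_smul_eq hb.isUnit]

/-- The inequality satisfied by a pair of independent unit vectors. -/
def UnitPairInequality (K : Set (Rn n)) : Prop :=
  ∀ v w : Rn n, ‖v‖ = 1 → ‖w‖ = 1 → LinearIndependent ℝ ![v, w] →
    4 * √(1 - ⟪v, w⟫_ℝ ^ 2) * projVol (n - 2) K (Submodule.span ℝ {v, w})ᗮ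
      + ∫ u, |⟪u, v⟫_ℝ| * |⟪u, w⟫_ℝ| / supportFn K u ∂(surfaceAreaMeasure K)
    ≤ 4 * projVol (n - 1) K (Submodule.span ℝ {v})ᗮ
        * projVol (n - 1) K (Submodule.span ℝ {w})ᗮ / volume.real K

/-- Every term is positively homogeneous of degree one in `v` and in `w`, so normalising both
vectors reduces to the unit case. -/
theorem UnitPairInequality.of_linearIndependent (hyp : UnitPairInequality K) {v w : Rn n}
    (h : LinearIndependent ℝ ![v, w]) :
    segmentRate₂ K v w + ∫ u, |⟪u, v⟫_ℝ| * |⟪u, w⟫_ℝ| / supportFn K u ∂(surfaceAreaMeasure K)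
      ≤ segmentRate K v * segmentRate K w / volume.real K := by
  have hv : v ≠ 0 := by simpa using h.ne_zero 0
  have hw : w ≠ 0 := by simpa using h.ne_zero 1
  have hv' : 0 < ‖v‖ := norm_pos_iff.2 hv
  have hw' : 0 < ‖w‖ := norm_pos_iff.2 hw
  obtain ⟨a, ha⟩ : ∃ a, a = ‖v‖ := ⟨_, rfl⟩
  obtain ⟨b, hb⟩ : ∃ b, b = ‖w‖ := ⟨_, rfl⟩
  obtain ⟨x, hx⟩ : ∃ x, x = a⁻¹ • v := ⟨_, rfl⟩
  obtain ⟨y, hy⟩ : ∃ y, y = b⁻¹ • w := ⟨_, rfl⟩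
  rw [← ha] at hv'
  rw [← hb] at hw'
  have hx1 : ‖x‖ = 1 := by
    rw [hx, norm_smul, norm_inv, Real.norm_of_nonneg hv'.le, ← ha, inv_mul_cancel₀ hv'.ne']
  have hy1 : ‖y‖ = 1 := by
    rw [hy, norm_smul, norm_inv, Real.norm_of_nonneg hw'.le, ← hb, inv_mul_cancel₀ hw'.ne']
  have hvx : v = a • x := by rw [hx, smul_inv_smul₀ hv'.ne']
  have hwy : w = b • y := by rw [hy, smul_inv_smul₀ hw'.ne']
  have hind : LinearIndependent ℝ ![x, y] := by
    rw [LinearIndependent.pair_iff] at h ⊢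
    intro s t hst
    have := h (s * a⁻¹) (t * b⁻¹) (by rw [mul_smul, mul_smul, ← hx, ← hy, hst])
    simpa [hv'.ne', hw'.ne'] using this
  have key := hyp x y hx1 hy1 hind
  have hspan1 : ∀ {c : ℝ} (z : Rn n), c ≠ 0 → Submodule.span ℝ {c • z} = Submodule.span ℝ {z} :=
    fun z hc => Submodule.span_singleton_smul_eq hc.isUnit z
  have hproj : ‖hyperProj v w‖ = b * √(1 - ⟪x, y⟫_ℝ ^ 2) := by
    rw [← norm_hyperProj_of_norm_eq_one hx1 hy1, hwy, map_smul, norm_smul,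
      Real.norm_of_nonneg hw'.le]
    have : ∀ W W' : Submodule ℝ (Rn n), W = W' →
        ‖W.orthogonalProjectionOnto y‖ = ‖W'.orthogonalProjectionOnto y‖ := by rintro W _ rfl; rfl
    rw [this _ _ (by rw [hvx, hspan1 x hv'.ne'] : (ℝ ∙ v)ᗮ = (ℝ ∙ x)ᗮ)]
  have hint : ∫ u, |⟪u, v⟫_ℝ| * |⟪u, w⟫_ℝ| / supportFn K u ∂(surfaceAreaMeasure K) =
      a * b * ∫ u, |⟪u, x⟫_ℝ| * |⟪u, y⟫_ℝ| / supportFn K u ∂(surfaceAreaMeasure K) := by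
    rw [← integral_const_mul]
    congr 1; ext u
    rw [hvx, hwy, inner_smul_right, inner_smul_right, abs_mul, abs_mul, abs_of_pos hv',
      abs_of_pos hw']
    ring
  rw [segmentRate₂_eq_projVol h, segmentRate_eq_projVol hv, segmentRate_eq_projVol hw, hproj, hint,
    ← ha, ← hb, hvx, hwy, span_pair_smul hv'.ne' hw'.ne', hspan1 x hv'.ne', hspan1 y hw'.ne']
  have := mul_le_mul_of_nonneg_left key (mul_pos hv' hw').le
  calc _ = a * b * (4 * √(1 - ⟪x, y⟫_ℝ ^ 2) * projVol (n - 2) K (Submodule.span ℝ {x, y})ᗮ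
      + ∫ u, |⟪u, x⟫_ℝ| * |⟪u, y⟫_ℝ| / supportFn K u ∂(surfaceAreaMeasure K)) := by ring
    _ ≤ _ := this
    _ = _ := by ring

theorem UnitPairInequality.integral_le (hn : 2 ≤ n) (hK : IsSymmConvexBody K)
    (hyp : UnitPairInequality K) {v : Rn n} (hv : v ≠ 0) (w : Rn n) :
    ∫ u, |⟪u, v⟫_ℝ| * |⟪u, w⟫_ℝ| / supportFn K u ∂(surfaceAreaMeasure K)
      ≤ segmentRate K v * segmentRate K w / volume.real K := by
  by_cases h : LinearIndependent ℝ ![v, w]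
  · linarith [hyp.of_linearIndependent h, segmentRate₂_nonneg K v w]
  obtain ⟨c, rfl⟩ : ∃ c : ℝ, c • v = w := by
    by_contra! hc
    exact h ((LinearIndependent.pair_iff' hv).2 hc)
  -- As `n ≥ 2`, some `x` lies off the line of `v`; perturbing `c • v` by small multiples of `x`
  -- gives vectors independent of `v`. The mixed rate is dropped before the limit, so its continuity
  -- is not needed.
  obtain ⟨x, hx⟩ : ∃ x : Rn n, ∀ c : ℝ, c • v ≠ x := by
    by_contra! hall
    have := finrank_le_one v hall
    rw [finrank_euclideanSpace_fin] at this
    omega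
  let y : ℕ → Rn n := fun k => c • v + (1 / ((k : ℝ) + 1)) • x
  have hy : Tendsto y atTop (𝓝 (c • v)) := by
    simpa [y] using
      (tendsto_one_div_add_atTop_nhds_zero_nat (𝕜 := ℝ)).smul_const x |>.const_add (c • v)
  have hyind : ∀ k, LinearIndependent ℝ ![v, y k] := fun k => by
    refine (LinearIndependent.pair_iff' hv).2 fun d hd => ?_
    have hk : (k : ℝ) + 1 ≠ 0 := by positivity
    refine hx (((k : ℝ) + 1) * (d - c)) ?_
    rw [mul_smul, sub_smul, hd]
    simp only [y, add_sub_cancel_left, smul_smul]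
    rw [mul_one_div_cancel hk, one_smul]
  have hI := tendsto_integral_supportFn_mul hK
    (tendstoHausdorff_symmSegment (tendsto_const_nhds (x := v) (f := atTop)))
    (tendstoHausdorff_symmSegment hy) (isCompact_symmSegment _) (zero_mem_symmSegment _)
    (fun _ => isCompact_symmSegment _) (fun _ => zero_mem_symmSegment _)
    (isCompact_symmSegment _) (zero_mem_symmSegment _)
    (fun _ => isCompact_symmSegment _) (fun _ => zero_mem_symmSegment _)
  simp_rw [supportFn_symmSegment] at hI
  refine le_of_tendsto_of_tendsto' hI
    (((tendsto_segmentRate hK hy).const_mul (segmentRate K v)).div_const (volume.real K))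
    fun k => ?_
  linarith [hyp.of_linearIndependent (hyind k), segmentRate₂_nonneg K v (y k)]

theorem UnitPairInequality.pair_le (hn : 2 ≤ n) (hK : IsSymmConvexBody K)
    (hyp : UnitPairInequality K) (v w : Rn n) :
    segmentRate₂ K v w + ∫ u, |⟪u, v⟫_ℝ| * |⟪u, w⟫_ℝ| / supportFn K u ∂(surfaceAreaMeasure K)
      ≤ segmentRate K v * segmentRate K w / volume.real K := by
  rcases eq_or_ne v 0 with rfl | hv
  · simp [segmentRate₂, segmentRate]
  by_cases h : LinearIndependent ℝ ![v, w]
  · exact hyp.of_linearIndependent h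
  obtain ⟨c, hc⟩ : ∃ c : ℝ, c • v = w := by
    by_contra! hc
    exact h ((LinearIndependent.pair_iff' hv).2 hc)
  have h0 : hyperProj v w = 0 := by
    have := hyperProj_smul_add (e := v) c 0
    rw [ZeroMemClass.coe_zero, add_zero, hc] at this
    exact this
  have h2 : segmentRate₂ K v w = 0 := by rw [segmentRate₂, h0]; simp [segmentRate]
  rw [h2, zero_add]
  exact hyp.integral_le hn hK hv w

end PairInequality

/-! ### Summation over pairs, and Hausdorff limits of zonotopes -/

section ZonoidInequality

variable {n : ℕ} {K : Set (Rn n)}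

theorem integrable_div_supportFn (hK : IsSymmConvexBody K) {f : Rn n → ℝ} (hf : Continuous f) :
    Integrable (fun u => f u / supportFn K u) (surfaceAreaMeasure K) := by
  have := isFiniteMeasure_surfaceAreaMeasure hK.isCompact
  obtain ⟨r, hr, hKr⟩ := hK.exists_closedBall_subset
  obtain ⟨C, hC⟩ := (isCompact_sphere (0 : Rn n) 1).exists_bound_of_continuousOn hf.continuousOn
  refine Integrable.of_bound (hf.measurable.div
    (continuous_supportFn hK.isCompact).measurable).aestronglyMeasurable (C / r) ?_
  filter_upwards [ae_norm_eq_one_surfaceAreaMeasure hK.isCompact] with u hu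
  have h1 := le_supportFn_of_closedBall_subset hK.isCompact hr.le hKr hu
  have h2 := hC u (by simpa using hu)
  rw [norm_div, Real.norm_of_nonneg (hr.le.trans h1)]
  have h3 := (norm_nonneg _).trans h2
  gcongr

theorem UnitPairInequality.zonotope_cross_le (hn : 2 ≤ n) (hK : IsSymmConvexBody K)
    (hyp : UnitPairInequality K) (v : Rn n) (l : List (Rn n)) :
    (l.map (segmentRate₂ K v)).sum
        + ∫ u, |⟪u, v⟫_ℝ| * supportFn (zonotope l) u / supportFn K u ∂(surfaceAreaMeasure K)
      ≤ segmentRate K v * (l.map (segmentRate K)).sum / volume.real K := by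
  induction l with
  | nil => simp [supportFn_zonotope]
  | cons w l ih =>
    have hpair := hyp.pair_le hn hK v w
    have hc := continuous_supportFn (isCompact_zonotope l)
    have hadd : ∫ u, |⟪u, v⟫_ℝ| * supportFn (zonotope (w :: l)) u / supportFn K u
          ∂(surfaceAreaMeasure K) =
        (∫ u, |⟪u, v⟫_ℝ| * |⟪u, w⟫_ℝ| / supportFn K u ∂(surfaceAreaMeasure K)) +
        ∫ u, |⟪u, v⟫_ℝ| * supportFn (zonotope l) u / supportFn K u ∂(surfaceAreaMeasure K) := by
      rw [← integral_add (integrable_div_supportFn hK (by fun_prop))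
        (integrable_div_supportFn hK (by fun_prop))]
      congr 1; ext u
      rw [supportFn_zonotope, supportFn_zonotope, List.map_cons, List.sum_cons]
      ring
    rw [hadd, List.map_cons, List.map_cons, List.sum_cons, List.sum_cons, mul_add, add_div]
    linarith

/-- A new generator `v` contributes one diagonal pair and, twice, its cross terms with the earlier
ones. The factor `2` stands before `pairRate` because that sum counts each unordered pair once. -/
theorem UnitPairInequality.zonotope_le (hn : 2 ≤ n) (hK : IsSymmConvexBody K)
    (hyp : UnitPairInequality K) (l : List (Rn n)) :
    2 * pairRate K l + ∫ u, supportFn (zonotope l) u * supportFn (zonotope l) u / supportFn K u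
        ∂(surfaceAreaMeasure K)
      ≤ (l.map (segmentRate K)).sum ^ 2 / volume.real K := by
  induction l with
  | nil => simp [supportFn_zonotope, pairRate]
  | cons v l ih =>
    have hcross := hyp.zonotope_cross_le hn hK v l
    have hdiag := hyp.pair_le hn hK v v
    -- `pairRate` has no diagonal terms, so the mixed rate of `v` with itself is discarded by sign.
    have hnonneg := segmentRate₂_nonneg K v v
    have hc := continuous_supportFn (isCompact_zonotope l)
    have h11 : Integrable (fun u => |⟪u, v⟫_ℝ| * |⟪u, v⟫_ℝ| / supportFn K u)
        (surfaceAreaMeasure K) := integrable_div_supportFn hK (by fun_prop)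
    have h12 : Integrable (fun u => |⟪u, v⟫_ℝ| * supportFn (zonotope l) u / supportFn K u)
        (surfaceAreaMeasure K) := integrable_div_supportFn hK (by fun_prop)
    have h22 : Integrable (fun u => supportFn (zonotope l) u * supportFn (zonotope l) u /
        supportFn K u) (surfaceAreaMeasure K) := integrable_div_supportFn hK (by fun_prop)
    have hsum : Integrable (fun u => 2 * (|⟪u, v⟫_ℝ| * supportFn (zonotope l) u / supportFn K u) +
        supportFn (zonotope l) u * supportFn (zonotope l) u / supportFn K u)
        (surfaceAreaMeasure K) := (h12.const_mul 2).add h22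
    have hadd : ∫ u, supportFn (zonotope (v :: l)) u * supportFn (zonotope (v :: l)) u /
          supportFn K u ∂(surfaceAreaMeasure K) =
        (∫ u, |⟪u, v⟫_ℝ| * |⟪u, v⟫_ℝ| / supportFn K u ∂(surfaceAreaMeasure K)) +
        (2 * (∫ u, |⟪u, v⟫_ℝ| * supportFn (zonotope l) u / supportFn K u
          ∂(surfaceAreaMeasure K)) +
        ∫ u, supportFn (zonotope l) u * supportFn (zonotope l) u / supportFn K u
          ∂(surfaceAreaMeasure K)) := by
      rw [← integral_const_mul, ← integral_add (h12.const_mul 2) h22,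
        ← integral_add h11 hsum]
      congr 1; ext u
      rw [supportFn_zonotope, supportFn_zonotope, List.map_cons, List.sum_cons]
      ring
    rw [hadd, pairRate, List.map_cons, List.sum_cons]
    have hsq : (segmentRate K v + (l.map (segmentRate K)).sum) ^ 2 / volume.real K =
        segmentRate K v * segmentRate K v / volume.real K +
        (2 * (segmentRate K v * (l.map (segmentRate K)).sum / volume.real K) +
        (l.map (segmentRate K)).sum ^ 2 / volume.real K) := by ring
    rw [hsq]
    linarith

theorem IsZonotope.exists_list {Z : Set (Rn n)} (hZ : IsZonotope Z) :
    ∃ l : List (Rn n), Z = zonotope l := by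
  obtain ⟨N, v, rfl⟩ := hZ
  exact ⟨List.ofFn v, by simp [zonotope, List.map_ofFn, List.sum_ofFn]⟩

theorem tendstoHausdorff_of_hausdorffDist {Z : ℕ → Set (Rn n)} {M : Set (Rn n)}
    (hZ : ∀ k, IsCompact (Z k)) (hZ0 : ∀ k, (Z k).Nonempty) (hM : IsCompact M) (hM0 : M.Nonempty)
    (h : Tendsto (fun k => Metric.hausdorffDist (Z k) M) atTop (𝓝 0)) : TendstoHausdorff Z M := by
  have hsub : ∀ {A B : Set (Rn n)} {ε : ℝ}, IsCompact A → A.Nonempty → IsCompact B → B.Nonempty →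
      Metric.hausdorffDist A B < ε → A ⊆ B + Metric.closedBall 0 ε := by
    intro A B ε hA hA0 hB hB0 hAB a ha
    obtain ⟨b, hb, hab⟩ := Metric.exists_dist_lt_of_hausdorffDist_lt ha hAB
      (Metric.hausdorffEDist_ne_top_of_nonempty_of_bounded hA0 hB0 hA.isBounded hB.isBounded)
    exact ⟨b, hb, a - b, by rw [mem_closedBall_zero_iff, ← dist_eq_norm]; exact hab.le, by simp⟩
  -- The Hausdorff distance is an infimum; the added `1 / (k + 1)` provides the strict inequality
  -- needed to choose nearby points.
  refine ⟨fun k => Metric.hausdorffDist (Z k) M + 1 / ((k : ℝ) + 1),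
    by simpa using h.add (tendsto_one_div_add_atTop_nhds_zero_nat (𝕜 := ℝ)), fun k => ?_⟩
  have hk : (0 : ℝ) < 1 / ((k : ℝ) + 1) := by positivity
  have := Metric.hausdorffDist_nonneg (s := Z k) (t := M)
  exact ⟨by positivity, hsub (hZ k) (hZ0 k) hM hM0 (by linarith),
    hsub hM hM0 (hZ k) (hZ0 k) (by rw [Metric.hausdorffDist_comm]; linarith)⟩

theorem TendstoHausdorff.exists_tendsto {Z : ℕ → Set (Rn n)} {M : Set (Rn n)}
    (h : TendstoHausdorff Z M) {x : Rn n} (hx : x ∈ M) :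
    ∃ z : ℕ → Rn n, (∀ k, z k ∈ Z k) ∧ Tendsto z atTop (𝓝 x) := by
  obtain ⟨ε, hε, h⟩ := h
  have : ∀ k, ∃ z ∈ Z k, dist z x ≤ ε k := fun k => by
    obtain ⟨z, hz, b, hb, hzb⟩ := (h k).2.2 hx
    refine ⟨z, hz, ?_⟩
    rw [dist_comm, dist_eq_norm, ← hzb]
    simpa using hb
  choose z hz hd using this
  exact ⟨z, hz, tendsto_iff_dist_tendsto_zero.2
    (squeeze_zero (fun _ => dist_nonneg) hd hε)⟩

theorem TendstoHausdorff.mem_of_tendsto {Z : ℕ → Set (Rn n)} {M : Set (Rn n)}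
    (h : TendstoHausdorff Z M) (hM : IsClosed M) {z : ℕ → Rn n} (hz : ∀ k, z k ∈ Z k) {x : Rn n}
    (hx : Tendsto z atTop (𝓝 x)) : x ∈ M := by
  obtain ⟨ε, hε, h⟩ := h
  have : ∀ k, ∃ m ∈ M, dist m (z k) ≤ ε k := fun k => by
    obtain ⟨m, hm, b, hb, hmb⟩ := (h k).2.1 (hz k)
    refine ⟨m, hm, ?_⟩
    rw [dist_comm, dist_eq_norm, ← hmb]
    simpa using hb
  choose m hm hd using this
  have hmz : Tendsto (fun k => dist (m k) (z k)) atTop (𝓝 0) :=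
    squeeze_zero (fun _ => dist_nonneg) hd hε
  refine hM.mem_of_tendsto (f := m) (b := atTop) ?_ (Eventually.of_forall hm)
  exact (tendsto_iff_of_dist hmz).2 hx

theorem TendstoHausdorff.convex {Z : ℕ → Set (Rn n)} {M : Set (Rn n)}
    (h : TendstoHausdorff Z M) (hM : IsClosed M) (hZ : ∀ k, Convex ℝ (Z k)) : Convex ℝ M := by
  intro x hx y hy a b ha hb hab
  obtain ⟨p, hp, hpx⟩ := h.exists_tendsto hx
  obtain ⟨q, hq, hqy⟩ := h.exists_tendsto hy
  exact h.mem_of_tendsto hM (fun k => hZ k (hp k) (hq k) ha hb hab)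
    ((hpx.const_smul a).add (hqy.const_smul b))

end ZonoidInequality

end LocalLogBM

/-! ### Passage from zonotopes to zonoids -/

theorem mainTheorem6 (n : ℕ) (hn : 2 ≤ n) (K : Set (LocalLogBM.Rn n))
    (hK : LocalLogBM.IsSymmConvexBody K)
    (hyp : ∀ v w : LocalLogBM.Rn n, ‖v‖ = 1 → ‖w‖ = 1 → LinearIndependent ℝ ![v, w] →
      4 * √(1 - ⟪v, w⟫_ℝ ^ 2) * LocalLogBM.projVol (n - 2) K (Submodule.span ℝ {v, w})ᗮ
        + ∫ u, |⟪u, v⟫_ℝ| * |⟪u, w⟫_ℝ| / LocalLogBM.supportFn K u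
            ∂(LocalLogBM.surfaceAreaMeasure K)
      ≤ 4 * LocalLogBM.projVol (n - 1) K (Submodule.span ℝ {v})ᗮ
          * LocalLogBM.projVol (n - 1) K (Submodule.span ℝ {w})ᗮ / volume.real K)
    (M : Set (LocalLogBM.Rn n)) (hM : LocalLogBM.IsZonoid M) :
    (n : ℝ) * ((n : ℝ) - 1) * LocalLogBM.mixedVol 2 K M
        + ∫ u, LocalLogBM.supportFn M u ^ 2 / LocalLogBM.supportFn K u
            ∂(LocalLogBM.surfaceAreaMeasure K)
      ≤ (n : ℝ) ^ 2 * LocalLogBM.mixedVol 1 K M ^ 2 / volume.real K := by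
  open LocalLogBM in
  have hyp : UnitPairInequality K := hyp
  obtain ⟨hMc, hM0, Z, hZ, hlim⟩ := hM
  choose l hl using fun k => (hZ k).exists_list
  obtain rfl : Z = fun k => zonotope (l k) := funext hl
  have hZc : ∀ k, IsCompact (zonotope (l k)) := fun k => isCompact_zonotope _
  have hZ0 : ∀ k, 0 ∈ zonotope (l k) := fun k => zero_mem_zonotope _
  have hZv : ∀ k, Convex ℝ (zonotope (l k)) := fun k => convex_zonotope _
  have hT : TendstoHausdorff (fun k => zonotope (l k)) M :=
    tendstoHausdorff_of_hausdorffDist hZc (fun k => ⟨0, hZ0 k⟩) hMc hM0 hlim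
  have hM0 : (0 : Rn n) ∈ M := hT.mem_of_tendsto hMc.isClosed hZ0 tendsto_const_nhds
  have hMv : Convex ℝ M := hT.convex hMc.isClosed hZv
  choose p hpd hp hp0 hp1 hp2 using fun k =>
    exists_polynomial_volume_add_zonotope (l k) hK.isCompact hK.convex
  obtain ⟨q, hq, hpq⟩ := exists_polynomial_limit (f := fun t => volume.real (K + t • M)) hpd
    fun t ht => by
      simp_rw [← fun k => hp k t ht]
      exact (hT.smul ht).tendsto_volume_add hK (hMv.smul t) (hMc.smul t)
        ⟨0, hM0, smul_zero t⟩ (fun k => (hZv k).smul t) (fun k => (hZc k).smul t)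
        fun k => ⟨0, hZ0 k, smul_zero t⟩
  have hI := tendsto_integral_supportFn_mul hK hT hT hMc hM0 hZc hZ0 hMc hM0 hZc hZ0
  have hmain : 2 * q.coeff 2 + ∫ u, supportFn M u * supportFn M u / supportFn K u
      ∂(surfaceAreaMeasure K) ≤ q.coeff 1 ^ 2 / volume.real K := by
    refine le_of_tendsto_of_tendsto' (((hpq 2).const_mul 2).add hI)
      (((hpq 1).pow 2).div_const _) fun k => ?_
    rw [hp1, hp2]
    exact hyp.zonotope_le hn hK (l k)
  -- The factorials in the mixed volumes turn `n V₁` into the linear coefficient and `n(n-1) V₂`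
  -- into twice the quadratic one; with `n = m + 2` the truncated subtractions compute.
  obtain ⟨m, rfl⟩ := Nat.exists_eq_add_of_le' hn
  have hf1 : ((m + 2 : ℕ) : ℝ) * mixedVol 1 K M = q.coeff 1 := by
    rw [mixedVol_eq_coeff hq, show m + 2 - 1 = m + 1 from rfl, Nat.factorial_succ (m + 1)]
    have : ((m + 1).factorial : ℝ) ≠ 0 := by exact_mod_cast (m + 1).factorial_ne_zero
    push_cast
    rw [show (m : ℝ) + 1 + 1 = m + 2 by ring]
    field_simp
    simp
  have hf2 : ((m + 2 : ℕ) : ℝ) * (((m + 2 : ℕ) : ℝ) - 1) * mixedVol 2 K M = 2 * q.coeff 2 := by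
    rw [mixedVol_eq_coeff hq, show m + 2 - 2 = m from rfl, Nat.factorial_succ (m + 1),
      Nat.factorial_succ m]
    have : (m.factorial : ℝ) ≠ 0 := by exact_mod_cast m.factorial_ne_zero
    push_cast
    rw [show (m : ℝ) + 2 - 1 = m + 1 by ring, show (m : ℝ) + 1 + 1 = m + 2 by ring]
    field_simp
    simp
  rw [hf2, ← mul_pow, hf1]
  simpa only [sq] using hmain
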